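/- For a sequence $\alpha=\{\alpha(j)\}_{j\ge0}$ of complex numbers let $H(\alpha)$ be the Hankel matrix $\{\alpha(j+k)\}_{j,k\ge0}$ acting on $\ell^2(\mathbb Z_+)$, $\mathbb Z_+=\{0,1,2,\dots\}$. For a function $\mathbf a$ on $(0,\infty)$ let $\mathbf H(\mathbf a)$ be the integral Hankel operator $$(\mathbf H(\mathbf a)\mathbf f)(t)=\int_0^\infty \mathbf a(t+s)\mathbf f(s)\,ds,\qquad t>0,$$ on $L^2(0,\infty)$. For $0<p<\infty$, the Schatten class $\mathbf S_p$ consists of the compact operators $A$ with $\|A\|_{\mathbf S_p}^p:=\sum_n s_n(A)^p<\infty$, where $s_n(A)$ are the singular values of $A$ counted with multiplicities. For $\lambda>0$ and a continuous $\mathbf a$ let $\mathcal R_{\delta_\lambda}\mathbf a$ be the sequence $(\mathcal R_{\delta_\lambda}\mathbf a)(j)=\mathbf a(j+\lambda)$, $j\ge0$. (i) There exist $\mathbf a\in C^\infty(\mathbb R;\mathbb C)$ with $\operatorname{supp}\mathbf a\subset[1/2,2]$ and $\mathbf a(1)=1$. For any such $\mathbf a$ set $\mathbf a^{(N)}(t)=\mathbf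 a(1+N(t-1))$ for $N=1,2,3,\dots$. Then: - for all $N\ge1$, $\operatorname{supp}\mathbf a^{(N)}\subset[1-\tfrac1{2N},1+\tfrac1N]$, $(\mathcal R_{\delta_1}\mathbf a^{(N)})(0)=1$ and $(\mathcal R_{\delta_1}\mathbf a^{(N)})(j)=0$ for all $j\ge1$; - for all $N\ge1$ the operators $\mathbf H(\mathbf a^{(N)})$ and $H(\mathcal R_{\delta_1}\mathbf a^{(N)})$ are bounded, and for all $1\le p<\infty$ they belong to $\mathbf S_p$ and $\|H(\mathcal R_{\delta_1}\mathbf a^{(N)})\|_{\mathbf S_p}=1$; - for every $1\le p<\infty$ there is a constant $C$, depending only on $p$ and $\mathbf a$, such that $$\|\mathbf H(\mathbf a^{(N)})\|_{\mathbf S_p}^p\le C N^{1-p}\qquad\text{for all }N\ge1;$$ - consequently, for every $1<p<\infty$, $\|\mathbf H(\mathbf a^{(N)})\|_{\mathbf S_p}^p\to0$ as $N\to\infty$. (ii) For every $1<p<\infty$ and every $\lambda>0$ there is no constant $C$ for which the estimate $$\|H(\mathcal R_{\delta_\lambda}\mathbf b)\|_{\mathbf S_p}\le C\,\|\mathbf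 H(\mathbf b)\|_{\mathbf S_p}$$ holds for all kernels $\mathbf b$, even if one considers only those $\mathbf b\in C^\infty(\mathbb R;\mathbb C)$ with compact support in $(0,\infty)$ for which both operators are in $\mathbf S_p$. (For $0<p\le1$ the estimate holds with $C=C_p(1+1/\lambda)$.) -/

import Mathlib

open MeasureTheory Set Filter Topology
open scoped ENNReal ContDiff

noncomputable section

/-- The multiplicity of `σ` as a singular value of `A`: the dimension of the eigenspace of
`A* A` for the eigenvalue `σ ^ 2`. It is zero if `σ > 0` is not a singular value of `A`. -/
def singularMultiplicity {E : Type*} [NormedAddCommGroup E] [InnerProductSpace ℂ E]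
    [CompleteSpace E] (A : E →L[ℂ] E) (σ : ℝ) : ℕ :=
  Module.finrank ℂ
    (Module.End.eigenspace
      ((ContinuousLinearMap.adjoint A ∘L A : E →L[ℂ] E) : E →ₗ[ℂ] E) ((σ : ℂ) ^ 2))

/-- The sum of the `p`-th powers of the positive singular values of `A`, each one counted
with its multiplicity. -/
def schattenSum {E : Type*} [NormedAddCommGroup E] [InnerProductSpace ℂ E]
    [CompleteSpace E] (p : ℝ) (A : E →L[ℂ] E) : ℝ≥0∞ :=
  ∑' σ : Ioi (0 : ℝ), (singularMultiplicity A σ : ℝ≥0∞) * ENNReal.ofReal ((σ : ℝ) ^ p)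

/-- The Schatten class `S_p` of compact operators. -/
def MemSchatten {E : Type*} [NormedAddCommGroup E] [InnerProductSpace ℂ E]
    [CompleteSpace E] (p : ℝ) (A : E →L[ℂ] E) : Prop :=
  IsCompactOperator A ∧ schattenSum p A < ⊤

/-- The Schatten norm of an operator of class `S_p`. -/
def schattenNorm {E : Type*} [NormedAddCommGroup E] [InnerProductSpace ℂ E]
    [CompleteSpace E] (p : ℝ) (A : E →L[ℂ] E) : ℝ :=
  (schattenSum p A).toReal ^ (1 / p)

/-- The Hilbert space `ℓ²` of square summable sequences indexed by `0, 1, 2, …`. -/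
abbrev SeqL2 : Type := lp (fun _ : ℕ => ℂ) 2

/-- The Hilbert space `L²(0, ∞)`. -/
abbrev HalfLineL2 : Type := Lp ℂ 2 (volume.restrict (Ioi (0 : ℝ)))

/-- `A` is the bounded Hankel matrix `H(α) = {α (j + k)}`, as an operator on `ℓ²`. -/
def IsHankelMatrix (α : ℕ → ℂ) (A : SeqL2 →L[ℂ] SeqL2) : Prop :=
  ∀ (x : SeqL2) (k : ℕ), HasSum (fun j : ℕ => α (j + k) * x j) (A x k)

/-- `A` is the bounded integral Hankel operator `𝐇(a)` on `L²(0, ∞)` with kernel function `a`: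
`(A f)(t) = ∫₀^∞ a (t + s) f(s) ds`. -/
def IsIntegralHankel (a : ℝ → ℂ) (A : HalfLineL2 →L[ℂ] HalfLineL2) : Prop :=
  ∀ f : HalfLineL2, ∀ᵐ t ∂(volume.restrict (Ioi (0 : ℝ))),
    IntegrableOn (fun s : ℝ => a (t + s) * f s) (Ioi 0) ∧
      A f t = ∫ s in Ioi (0 : ℝ), a (t + s) * f s

/-- A bounded Hankel matrix is determined by its sequence. -/
theorem IsHankelMatrix.unique {α : ℕ → ℂ} {A B : SeqL2 →L[ℂ] SeqL2}
    (hA : IsHankelMatrix α A) (hB : IsHankelMatrix α B) : A = B := by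
  ext x k
  exact (hA x k).unique (hB x k)

/-- A bounded integral Hankel operator is determined by its kernel function. -/
theorem IsIntegralHankel.unique {a : ℝ → ℂ} {A B : HalfLineL2 →L[ℂ] HalfLineL2}
    (hA : IsIntegralHankel a A) (hB : IsIntegralHankel a B) : A = B := by
  refine ContinuousLinearMap.ext fun f => Lp.ext ?_
  filter_upwards [hA f, hB f] with t h1 h2
  rw [h1.2, h2.2]

/-- The pointwise restriction `j ↦ a (j + lam)` of a kernel function. -/
def pointwiseRestriction (lam : ℝ) (a : ℝ → ℂ) : ℕ → ℂ := fun j => a (j + lam)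

/-- Smooth functions `a` on the line with support in `[1/2, 2]` and `a 1 = 1`. -/
def IsBump (a : ℝ → ℂ) : Prop :=
  ContDiff ℝ ∞ a ∧ tsupport a ⊆ Icc (1 / 2) 2 ∧ a 1 = 1

/-- The rescaled function `t ↦ a (1 + N (t - 1))`. -/
def rescaledBump (a : ℝ → ℂ) (N : ℕ) : ℝ → ℂ := fun t => a (1 + N * (t - 1))

end

/-! Shrinking a bump around the sampling point leaves its samples at `j + lam` equal to 1, 0, 0, …,
and the Hankel matrix of that sequence is a rank one projection, with all Schatten norms 1. The
integral operator, in contrast, becomes small. Singular values at most `β` satisfy `σ ^ p ≤ β ^ (p -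
1) * σ` (`schattenSum_le`), so an operator norm of order `1 / N` and a trace norm bounded in `N`
give the rate `N ^ (1 - p)`.

The operator norm is controlled by Schur's test (`IsIntegralHankel.norm_inner_le`), the kernel
function having `L¹` norm of order `1 / N`. For the trace norm, Fourier inversion writes the kernel
function as a superposition of characters with integrable density `g`. A character of `t + s`
factors, so it contributes a rank one operator; since the kernel function vanishes on `(L, ∞)`, the
characters may be cut off to `(0, L]` (`isIntegralHankel_integral_rankOne`). The trace norm is then
at most `L * ∫ ‖g‖`. Rescaling the bump only changes the frequencies and the phase of `g`, so this
bound does not depend on `N`. -/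

/-! ### Schatten sums and integrals of rank one operators. -/

section Schatten

variable {E : Type*} [NormedAddCommGroup E] [InnerProductSpace ℂ E] [CompleteSpace E]

/-- Orthonormal left and right singular vectors for finitely many singular values. -/
theorem exists_orthonormal_singular_vectors (A : E →L[ℂ] E) (s : Finset (Ioi (0 : ℝ))) :
    ∃ e u : (Σ σ : s, Fin (singularMultiplicity A (σ : Ioi (0 : ℝ)))) → E,
      Orthonormal ℂ e ∧ Orthonormal ℂ u ∧
        ∀ x, A (e x) = (((x.1 : Ioi (0 : ℝ)) : ℝ) : ℂ) • u x := by
  set T : E →L[ℂ] E := ContinuousLinearMap.adjoint A ∘L A with hT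
  have hsymm : (T : E →ₗ[ℂ] E).IsSymmetric := fun x y => by
    simp [hT, ContinuousLinearMap.adjoint_inner_left, ContinuousLinearMap.adjoint_inner_right]
  have hinj : Function.Injective fun σ : s => (((σ : Ioi (0 : ℝ)) : ℝ) : ℂ) ^ 2 := by
    intro σ τ h
    have h' : ((σ : Ioi (0 : ℝ)) : ℝ) ^ 2 = ((τ : Ioi (0 : ℝ)) : ℝ) ^ 2 := by
      simp only at h
      exact_mod_cast h
    have := (pow_left_inj₀ (le_of_lt σ.1.2) (le_of_lt τ.1.2) two_ne_zero).1 h'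
    exact Subtype.ext (Subtype.ext this)
  have hfam := hsymm.orthogonalFamily_eigenspaces.comp hinj
  have hbasis : ∀ σ : s, ∃ v : Fin (singularMultiplicity A (σ : Ioi (0 : ℝ))) →
      Module.End.eigenspace (T : E →ₗ[ℂ] E) ((((σ : Ioi (0 : ℝ)) : ℝ) : ℂ) ^ 2),
      Orthonormal ℂ v := by
    intro σ
    -- The `finrank` of an infinite-dimensional eigenspace is also 0; the index type is then empty
    -- and there is nothing to choose.
    rcases Nat.eq_zero_or_pos (singularMultiplicity A (σ : Ioi (0 : ℝ))) with h | h
    · have : IsEmpty (Fin (singularMultiplicity A (σ : Ioi (0 : ℝ)))) := by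
        rw [h]; infer_instance
      exact ⟨fun i => isEmptyElim i, fun i => isEmptyElim i, fun i => isEmptyElim i⟩
    · have : FiniteDimensional ℂ
          (Module.End.eigenspace (T : E →ₗ[ℂ] E) ((((σ : Ioi (0 : ℝ)) : ℝ) : ℂ) ^ 2)) :=
        Module.finite_of_finrank_pos h
      exact ⟨_, (stdOrthonormalBasis ℂ
        (Module.End.eigenspace (T : E →ₗ[ℂ] E) ((((σ : Ioi (0 : ℝ)) : ℝ) : ℂ) ^ 2))).orthonormal⟩
  choose v hv using hbasis
  have he := hfam.orthonormal_sigma_orthonormal hv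
  set e : (Σ σ : s, Fin (singularMultiplicity A (σ : Ioi (0 : ℝ)))) → E :=
    fun x => (v x.1 x.2 : E) with he_def
  have he' : Orthonormal ℂ e := he
  have hTe : ∀ x, T (e x) = (((x.1 : Ioi (0 : ℝ)) : ℝ) : ℂ) ^ 2 • e x := fun x =>
    Module.End.mem_eigenspace_iff.1 (v x.1 x.2).2
  have hpos : ∀ x : (Σ σ : s, Fin (singularMultiplicity A (σ : Ioi (0 : ℝ)))),
      (((x.1 : Ioi (0 : ℝ)) : ℝ) : ℂ) ≠ 0 := fun x => by
    exact_mod_cast (ne_of_gt x.1.1.2)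
  refine ⟨e, fun x => (((x.1 : Ioi (0 : ℝ)) : ℝ) : ℂ)⁻¹ • A (e x), he', ?_, fun x => ?_⟩
  · classical
    rw [orthonormal_iff_ite] at he' ⊢
    intro x y
    have h1 : inner ℂ (A (e x)) (A (e y)) =
        (((y.1 : Ioi (0 : ℝ)) : ℝ) : ℂ) ^ 2 * inner ℂ (e x) (e y) := by
      rw [← inner_smul_right, ← hTe y, hT, ContinuousLinearMap.comp_apply,
        ContinuousLinearMap.adjoint_inner_right]
    rw [inner_smul_left, inner_smul_right, h1, he' x y]
    split_ifs with hxy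
    · subst hxy
      have := hpos x
      simp only [map_inv₀, Complex.conj_ofReal]
      field_simp
    · simp
  · rw [smul_smul, mul_inv_cancel₀ (hpos x), one_smul]

/-- A bound for the Schatten sum by a bound `K` for the traces in pairs of orthonormal systems
and a bound `β` for the norm. -/
theorem schattenSum_le {A : E →L[ℂ] E} {K β p : ℝ} (hp : 1 ≤ p) (hβ0 : 0 ≤ β)
    (hK : ∀ (ι : Type) [Fintype ι] (e u : ι → E), Orthonormal ℂ e → Orthonormal ℂ u →
      ‖∑ i, inner ℂ (u i) (A (e i))‖ ≤ K)
    (hβ : ∀ u e : E, ‖u‖ = 1 → ‖e‖ = 1 → ‖inner ℂ u (A e)‖ ≤ β) :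
    schattenSum p A ≤ ENNReal.ofReal (β ^ (p - 1) * K) := by
  -- The sum is a supremum over finite sets of singular values, so finite orthonormal systems
  -- suffice.
  rw [schattenSum, ENNReal.tsum_eq_iSup_sum]
  refine iSup_le fun s => ?_
  obtain ⟨e, u, he, hu, hAe⟩ := exists_orthonormal_singular_vectors A s
  have hinner : ∀ x, inner ℂ (u x) (A (e x)) = (((x.1 : Ioi (0 : ℝ)) : ℝ) : ℂ) := fun x => by
    rw [hAe, inner_smul_right, inner_self_eq_norm_sq_to_K, hu.1 x]
    simp
  have hσβ : ∀ x : (Σ σ : s, Fin (singularMultiplicity A (σ : Ioi (0 : ℝ)))),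
      ((x.1 : Ioi (0 : ℝ)) : ℝ) ≤ β := fun x => by
    have := hβ (u x) (e x) (hu.1 x) (he.1 x)
    rw [hinner, Complex.norm_real] at this
    exact (le_abs_self _).trans this
  have hsum : ∑ x : (Σ σ : s, Fin (singularMultiplicity A (σ : Ioi (0 : ℝ)))),
      ((x.1 : Ioi (0 : ℝ)) : ℝ) ≤ K := by
    have := hK _ e u he hu
    simp_rw [hinner] at this
    rw [← Complex.ofReal_sum, Complex.norm_real] at this
    exact (le_abs_self _).trans this
  have hpow : ∑ x : (Σ σ : s, Fin (singularMultiplicity A (σ : Ioi (0 : ℝ)))),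
      ((x.1 : Ioi (0 : ℝ)) : ℝ) ^ p ≤ β ^ (p - 1) * K := by
    refine le_trans ?_ (mul_le_mul_of_nonneg_left hsum (Real.rpow_nonneg hβ0 _))
    rw [Finset.mul_sum]
    refine Finset.sum_le_sum fun x _ => ?_
    have hx : 0 < ((x.1 : Ioi (0 : ℝ)) : ℝ) := x.1.1.2
    calc ((x.1 : Ioi (0 : ℝ)) : ℝ) ^ p
        = ((x.1 : Ioi (0 : ℝ)) : ℝ) ^ (p - 1) * ((x.1 : Ioi (0 : ℝ)) : ℝ) := by
          rw [← Real.rpow_add_one hx.ne']; ring_nf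
      _ ≤ _ := mul_le_mul_of_nonneg_right
          (Real.rpow_le_rpow hx.le (hσβ x) (by linarith)) hx.le
  refine le_trans (le_of_eq ?_) (ENNReal.ofReal_le_ofReal hpow)
  rw [ENNReal.ofReal_sum_of_nonneg fun x _ => Real.rpow_nonneg (le_of_lt x.1.1.2) _,
    Fintype.sum_sigma, ← Finset.sum_coe_sort s]
  simp

/-- Pairing an integral of rank one operators with two orthonormal systems. -/
theorem norm_sum_inner_integral_rankOne_le {g : ℝ → ℂ} {φ ψ : ℝ → E} {M : ℝ} {A : E →L[ℂ] E}
    (hg : Integrable g)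
    (hint : Integrable fun ξ => g ξ • InnerProductSpace.rankOne ℂ (φ ξ) (ψ ξ))
    (hA : A = ∫ ξ, g ξ • InnerProductSpace.rankOne ℂ (φ ξ) (ψ ξ))
    (hφ : ∀ ξ, ‖φ ξ‖ ^ 2 ≤ M) (hψ : ∀ ξ, ‖ψ ξ‖ ^ 2 ≤ M)
    {ι : Type*} [Fintype ι] {e u : ι → E} (he : Orthonormal ℂ e) (hu : Orthonormal ℂ u) :
    ‖∑ i, inner ℂ (u i) (A (e i))‖ ≤ M * ∫ ξ, ‖g ξ‖ := by
  -- The pairing is a continuous linear functional of the operator, hence passes under the integral.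
  let Λ : (E →L[ℂ] E) →L[ℂ] ℂ :=
    ∑ i, (innerSL ℂ (u i)) ∘L (ContinuousLinearMap.apply ℂ E (e i))
  have hΛ : ∀ S, Λ S = ∑ i, inner ℂ (u i) (S (e i)) := fun S => by simp [Λ]
  rw [← hΛ, hA, ← ContinuousLinearMap.integral_comp_comm _ hint, ← integral_const_mul]
  refine norm_integral_le_of_norm_le (hg.norm.const_mul M) (Eventually.of_forall fun ξ => ?_)
  rw [map_smul, norm_smul, mul_comm]
  refine mul_le_mul_of_nonneg_right ?_ (norm_nonneg _)
  rw [hΛ]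
  simp_rw [InnerProductSpace.inner_right_rankOne_apply]
  have h1 := hu.sum_inner_products_le (φ ξ) (s := Finset.univ)
  have h2 := he.sum_inner_products_le (ψ ξ) (s := Finset.univ)
  -- The arithmetic-geometric mean inequality separates the two systems; Bessel's inequality bounds
  -- each of them.
  calc ‖∑ i, inner ℂ (u i) (φ ξ) * inner ℂ (ψ ξ) (e i)‖
      ≤ ∑ i, ‖inner ℂ (u i) (φ ξ) * inner ℂ (ψ ξ) (e i)‖ := norm_sum_le _ _
    _ ≤ ∑ i, (‖inner ℂ (u i) (φ ξ)‖ ^ 2 + ‖inner ℂ (e i) (ψ ξ)‖ ^ 2) / 2 := by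
        refine Finset.sum_le_sum fun i _ => ?_
        rw [norm_mul, norm_inner_symm (ψ ξ)]
        nlinarith [sq_nonneg (‖inner ℂ (u i) (φ ξ)‖ - ‖inner ℂ (e i) (ψ ξ)‖)]
    _ ≤ M := by
        rw [← Finset.sum_div, Finset.sum_add_distrib]
        linarith [hφ ξ, hψ ξ]

/-- An integral of rank one operators is compact. -/
theorem isCompactOperator_integral_rankOne {g : ℝ → ℂ} {φ ψ : ℝ → E}
    (hint : Integrable fun ξ => g ξ • InnerProductSpace.rankOne ℂ (φ ξ) (ψ ξ)) :
    IsCompactOperator (∫ ξ, g ξ • InnerProductSpace.rankOne ℂ (φ ξ) (ψ ξ) : E →L[ℂ] E) := by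
  let W : Submodule ℂ (E →L[ℂ] E) := compactOperator (RingHom.id ℂ) E E
  have hW : IsClosed (W : Set (E →L[ℂ] E)) := isClosed_setOfPred_isCompactOperator
  have hmem : ∀ ξ, g ξ • InnerProductSpace.rankOne ℂ (φ ξ) (ψ ξ) ∈ W := fun ξ => by
    refine W.smul_mem _ ?_
    change IsCompactOperator _
    rw [InnerProductSpace.rankOne_def']
    exact (isCompactOperator_of_locallyCompactSpace_rng
      (ContinuousLinearMap.toSpanSingleton ℂ (φ ξ))).comp_clm _
  have : IsClosed (W : Set (E →L[ℂ] E)) := hW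
  -- The compact operators form a closed subspace `W`; the quotient map by `W` kills the integrand,
  -- hence the integral.
  have h := ContinuousLinearMap.integral_comp_comm W.mkQL hint
  have h0 : ∀ ξ, W.mkQL (g ξ • InnerProductSpace.rankOne ℂ (φ ξ) (ψ ξ)) = 0 := fun ξ =>
    (Submodule.Quotient.mk_eq_zero W).2 (hmem ξ)
  simp only [h0, integral_zero] at h
  exact (Submodule.Quotient.mk_eq_zero W).1 h.symm

end Schatten

/-! ### Schatten norms of a rank one projection. -/

section RankOneProjection

variable {E : Type*} [NormedAddCommGroup E] [InnerProductSpace ℂ E] [CompleteSpace E]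

theorem adjoint_comp_rankOne_self {x : E} (hx : ‖x‖ = 1) :
    ContinuousLinearMap.adjoint (InnerProductSpace.rankOne ℂ x x) ∘L
      InnerProductSpace.rankOne ℂ x x = InnerProductSpace.rankOne ℂ x x := by
  refine ContinuousLinearMap.ext fun y => ext_inner_left ℂ fun z => ?_
  simp [inner_smul_right, hx]

/-- Here `A* A` is the projection itself, whose only nonzero eigenvalue is 1, with the line through
`x` as eigenspace; `σ > 0` excludes `σ = -1`. -/
theorem singularMultiplicity_rankOne_self {x : E} (hx : ‖x‖ = 1) {σ : ℝ} (hσ : 0 < σ) :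
    singularMultiplicity (InnerProductSpace.rankOne ℂ x x) σ = if σ = 1 then 1 else 0 := by
  have hx0 : x ≠ 0 := fun h => by simp [h] at hx
  have hσ0 : (σ : ℂ) ^ 2 ≠ 0 := by
    have : (σ : ℂ) ≠ 0 := by exact_mod_cast hσ.ne'
    exact pow_ne_zero _ this
  rw [singularMultiplicity, adjoint_comp_rankOne_self hx]
  split_ifs with h1
  · have : Module.End.eigenspace
        ((InnerProductSpace.rankOne ℂ x x : E →L[ℂ] E) : E →ₗ[ℂ] E) ((σ : ℂ) ^ 2) = ℂ ∙ x := by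
      ext y
      rw [Module.End.mem_eigenspace_iff, Submodule.mem_span_singleton]
      simp only [h1, ContinuousLinearMap.coe_coe, InnerProductSpace.rankOne_apply,
        Complex.ofReal_one, one_pow, one_smul]
      refine ⟨fun h => ⟨_, h⟩, ?_⟩
      rintro ⟨c, rfl⟩
      simp [inner_smul_right, hx]
    rw [this, finrank_span_singleton hx0]
  · have : Module.End.eigenspace
        ((InnerProductSpace.rankOne ℂ x x : E →L[ℂ] E) : E →ₗ[ℂ] E) ((σ : ℂ) ^ 2) = ⊥ := by
      rw [eq_bot_iff]
      intro y hy
      rw [Module.End.mem_eigenspace_iff] at hy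
      simp only [ContinuousLinearMap.coe_coe, InnerProductSpace.rankOne_apply] at hy
      have h2 : inner ℂ x y = (σ : ℂ) ^ 2 * inner ℂ x y := by
        have := congrArg (inner ℂ x) hy
        simpa [inner_smul_right, hx] using this
      have h3 : ((σ : ℂ) ^ 2 - 1) * inner ℂ x y = 0 := by linear_combination -h2
      have h4 : (σ : ℂ) ^ 2 - 1 ≠ 0 := by
        intro h
        have h' : σ ^ 2 - 1 = 0 := by exact_mod_cast h
        have : (σ - 1) * (σ + 1) = 0 := by linear_combination h'
        rcases mul_eq_zero.1 this with h | h
        · exact h1 (by linarith)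
        · linarith
      have h5 := (mul_eq_zero.1 h3).resolve_left h4
      rw [h5, zero_smul] at hy
      exact (smul_eq_zero.1 hy.symm).resolve_left hσ0
    rw [this, finrank_bot]

theorem schattenSum_rankOne_self {x : E} (hx : ‖x‖ = 1) (p : ℝ) :
    schattenSum p (InnerProductSpace.rankOne ℂ x x) = 1 := by
  rw [schattenSum, tsum_eq_single (⟨1, mem_Ioi.2 one_pos⟩ : Ioi (0 : ℝ))]
  · rw [singularMultiplicity_rankOne_self hx one_pos]
    simp
  · rintro ⟨σ, hσ⟩ h
    rw [singularMultiplicity_rankOne_self hx hσ, if_neg fun h' => h (Subtype.ext h')]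
    simp

theorem memSchatten_rankOne_self {x : E} (hx : ‖x‖ = 1) (p : ℝ) :
    MemSchatten p (InnerProductSpace.rankOne ℂ x x) := by
  refine ⟨?_, by rw [schattenSum_rankOne_self hx]; exact ENNReal.one_lt_top⟩
  rw [InnerProductSpace.rankOne_def']
  exact (isCompactOperator_of_locallyCompactSpace_rng
    (ContinuousLinearMap.toSpanSingleton ℂ x)).comp_clm _

theorem schattenNorm_rankOne_self {x : E} (hx : ‖x‖ = 1) (p : ℝ) :
    schattenNorm p (InnerProductSpace.rankOne ℂ x x) = 1 := by
  rw [schattenNorm, schattenSum_rankOne_self hx]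
  simp

end RankOneProjection

/-- The Hankel matrix of the sequence `1, 0, 0, …` is a projection of rank one. -/
theorem isHankelMatrix_rankOne {α : ℕ → ℂ} (h0 : α 0 = 1) (h1 : ∀ j, 1 ≤ j → α j = 0) :
    IsHankelMatrix α (InnerProductSpace.rankOne ℂ
      (lp.single 2 0 (1 : ℂ) : SeqL2) (lp.single 2 0 (1 : ℂ))) := by
  intro x k
  have hval : (InnerProductSpace.rankOne ℂ
      (lp.single 2 0 (1 : ℂ) : SeqL2) (lp.single 2 0 (1 : ℂ)) x) k =
      α (0 + k) * x 0 := by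
    rw [InnerProductSpace.rankOne_apply, lp.inner_single_left]
    rcases Nat.eq_zero_or_pos k with rfl | hk
    · simp [h0]
    · simp [h1 k hk, hk.ne']
  rw [hval]
  refine hasSum_single 0 fun j hj => ?_
  rw [h1 (j + k) (by omega), zero_mul]

theorem norm_single_zero_one : ‖(lp.single 2 0 (1 : ℂ) : SeqL2)‖ = 1 := by
  simp

/-! ### Truncated characters in `L²(0, ∞)`. -/

/-- The function `t ↦ exp (i w t)` on `(0, L]`, extended by zero. -/
noncomputable def truncatedChar (L w : ℝ) : ℝ → ℂ :=
  (Ioc 0 L).indicator fun t => Complex.exp (((w * t : ℝ) : ℂ) * Complex.I)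

theorem memLp_truncatedChar (L w : ℝ) :
    MemLp (truncatedChar L w) 2 (volume.restrict (Ioi (0 : ℝ))) := by
  have hfin : (volume.restrict (Ioi (0 : ℝ))) (Ioc 0 L) ≠ ⊤ :=
    ((Measure.restrict_apply_le _ _).trans_lt measure_Ioc_lt_top).ne
  refine (memLp_indicator_const 2 measurableSet_Ioc (1 : ℝ) (Or.inr hfin)).of_le ?_ ?_
  · exact (Continuous.aestronglyMeasurable (by fun_prop)).indicator measurableSet_Ioc
  · refine Eventually.of_forall fun t => ?_
    by_cases ht : t ∈ Ioc 0 L <;> simp [truncatedChar, ht, Complex.norm_exp_ofReal_mul_I,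
      -Complex.ofReal_mul]

/-- The function `truncatedChar L w` as a vector of `L²(0, ∞)`. -/
noncomputable def truncatedCharLp (L w : ℝ) : HalfLineL2 := (memLp_truncatedChar L w).toLp

theorem coeFn_truncatedCharLp (L w : ℝ) :
    truncatedCharLp L w =ᵐ[volume.restrict (Ioi (0 : ℝ))] truncatedChar L w :=
  MemLp.coeFn_toLp _

theorem norm_le_of_ae_le_indicator {L c : ℝ} (hL : 0 ≤ L) (f : HalfLineL2)
    (h : ∀ᵐ t ∂(volume.restrict (Ioi (0 : ℝ))), ‖f t‖ ≤ (Ioc 0 L).indicator (fun _ => c) t) :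
    ‖f‖ ≤ |c| * √L := by
  have hle : (volume.restrict (Ioi (0 : ℝ))) (Ioc 0 L) ≤ ENNReal.ofReal L := by
    refine (Measure.restrict_apply_le _ _).trans ?_
    simp
  have hfin : (volume.restrict (Ioi (0 : ℝ))) (Ioc 0 L) ≠ ⊤ :=
    (hle.trans_lt ENNReal.ofReal_lt_top).ne
  refine (Lp.norm_le_norm_of_ae_le
    (g := indicatorConstLp 2 (measurableSet_Ioc (a := (0 : ℝ)) (b := L)) hfin c) ?_).trans ?_
  · filter_upwards [h, indicatorConstLp_coeFn (p := 2) (hs := measurableSet_Ioc (a := (0 : ℝ))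
      (b := L)) (hμs := hfin) (c := c)] with t h1 h2
    rw [h2]
    exact h1.trans (le_abs_self _)
  · rw [norm_indicatorConstLp (by norm_num) (by norm_num), Real.norm_eq_abs, Real.sqrt_eq_rpow]
    refine mul_le_mul_of_nonneg_left ?_ (abs_nonneg _)
    have hr : (volume.restrict (Ioi (0 : ℝ))).real (Ioc 0 L) ≤ L :=
      ENNReal.toReal_le_of_le_ofReal hL hle
    simpa using Real.rpow_le_rpow measureReal_nonneg hr (by norm_num : (0 : ℝ) ≤ 1 / 2)

theorem norm_truncatedCharLp_sq_le {L : ℝ} (hL : 0 ≤ L) (w : ℝ) :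
    ‖truncatedCharLp L w‖ ^ 2 ≤ L := by
  have h : ‖truncatedCharLp L w‖ ≤ |1| * √L := by
    refine norm_le_of_ae_le_indicator hL _ ?_
    filter_upwards [coeFn_truncatedCharLp L w] with t ht
    rw [ht]
    by_cases ht : t ∈ Ioc 0 L <;> simp [truncatedChar, ht, Complex.norm_exp_ofReal_mul_I,
      -Complex.ofReal_mul]
  calc ‖truncatedCharLp L w‖ ^ 2 ≤ (|1| * √L) ^ 2 := pow_le_pow_left₀ (norm_nonneg _) h 2
    _ = L := by rw [abs_one, one_mul, Real.sq_sqrt hL]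

/-- On `(0, L]` two characters differ by at most `L * |w - η|`, so the map is Lipschitz. This makes
the families of rank one operators measurable in operator norm. -/
theorem continuous_truncatedCharLp {L : ℝ} (hL : 0 ≤ L) : Continuous (truncatedCharLp L) := by
  have hlip : ∀ w η, ‖truncatedCharLp L w - truncatedCharLp L η‖ ≤ L * √L * |w - η| := by
    intro w η
    have h : ‖truncatedCharLp L w - truncatedCharLp L η‖ ≤ |(L * |w - η|)| * √L := by
      refine norm_le_of_ae_le_indicator hL _ ?_
      filter_upwards [coeFn_truncatedCharLp L w, coeFn_truncatedCharLp L η,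
        Lp.coeFn_sub (truncatedCharLp L w) (truncatedCharLp L η)] with t h1 h2 h3
      rw [h3, Pi.sub_apply, h1, h2]
      by_cases ht : t ∈ Ioc 0 L
      · simp only [truncatedChar, indicator_of_mem ht]
        have h4 : Complex.exp (((w * t : ℝ) : ℂ) * Complex.I) -
            Complex.exp (((η * t : ℝ) : ℂ) * Complex.I) =
            Complex.exp (((η * t : ℝ) : ℂ) * Complex.I) *
              (Complex.exp (Complex.I * (((w - η) * t : ℝ) : ℂ)) - 1) := by
          rw [mul_sub, ← Complex.exp_add, mul_one]
          push_cast
          ring_nf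
        rw [h4, norm_mul, Complex.norm_exp_ofReal_mul_I, one_mul]
        refine Real.norm_exp_I_mul_ofReal_sub_one_le.trans ?_
        rw [Real.norm_eq_abs, abs_mul, abs_of_pos ht.1, mul_comm]
        exact mul_le_mul_of_nonneg_right ht.2 (abs_nonneg _)
      · simp [truncatedChar, ht]
    rw [abs_of_nonneg (by positivity)] at h
    linarith
  refine (LipschitzWith.of_dist_le_mul (K := (L * √L).toNNReal) fun w η => ?_).continuous
  rw [dist_eq_norm, Real.dist_eq, Real.coe_toNNReal _ (by positivity)]
  exact hlip w η

/-! ### Hankel operators as integrals of rank one operators. -/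

/-- Integrability of the family of rank one operators in the Fourier representation. -/
theorem integrable_rankOne_truncatedChar {L : ℝ} (hL : 0 ≤ L) (w : ℝ) {g : ℝ → ℂ}
    (hg : Integrable g) :
    Integrable fun ξ => g ξ • InnerProductSpace.rankOne ℂ
      (truncatedCharLp L (w * ξ)) (truncatedCharLp L (-(w * ξ))) := by
  have hcont : Continuous fun ξ => InnerProductSpace.rankOne ℂ
      (truncatedCharLp L (w * ξ)) (truncatedCharLp L (-(w * ξ))) := by
    have h := continuous_truncatedCharLp hL
    have h1 : Continuous fun ξ => truncatedCharLp L (w * ξ) := h.comp (by fun_prop)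
    have h2 : Continuous fun ξ => truncatedCharLp L (-(w * ξ)) := h.comp (by fun_prop)
    exact ((ContinuousLinearMap.smulRightL ℂ HalfLineL2 HalfLineL2).continuous.comp
      ((innerSL ℂ).continuous.comp h2)).clm_apply h1
  refine hg.smul_bdd L hcont.aestronglyMeasurable (Eventually.of_forall fun ξ => ?_)
  rw [InnerProductSpace.norm_rankOne]
  nlinarith [norm_truncatedCharLp_sq_le hL (w * ξ), norm_truncatedCharLp_sq_le hL (-(w * ξ)),
    sq_nonneg (‖truncatedCharLp L (w * ξ)‖ - ‖truncatedCharLp L (-(w * ξ))‖)]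

/-- Fubini's theorem for a pairing with characters. -/
theorem integral_mul_integral_char_comm {μ : Measure ℝ} [SFinite μ] {h g : ℝ → ℂ} (w : ℝ)
    (hh : Integrable h μ) (hg : Integrable g) :
    ∫ s, (h s * ∫ ξ, g ξ * Complex.exp (((w * ξ * s : ℝ) : ℂ) * Complex.I)) ∂μ =
      ∫ ξ, g ξ * ∫ s, h s * Complex.exp (((w * ξ * s : ℝ) : ℂ) * Complex.I) ∂μ := by
  simp_rw [← integral_const_mul]
  rw [integral_integral_swap]
  · congr! 4
    ring
  · have h1 := (hh.mul_prod hg).mul_bdd (c := 1)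
      (g := fun z : ℝ × ℝ => Complex.exp (((w * z.2 * z.1 : ℝ) : ℂ) * Complex.I))
      (Continuous.aestronglyMeasurable (by fun_prop))
      (Eventually.of_forall fun z => (Complex.norm_exp_ofReal_mul_I _).le)
    refine h1.congr (Eventually.of_forall fun z => ?_)
    simp only [Function.uncurry, mul_assoc]

theorem truncatedChar_eq_mul (L w t : ℝ) :
    truncatedChar L w t = (Ioc 0 L).indicator 1 t *
      Complex.exp (((w * t : ℝ) : ℂ) * Complex.I) := by
  by_cases ht : t ∈ Ioc 0 L <;> simp [truncatedChar, ht]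

theorem integrable_mul_indicator (L : ℝ) {f : ℝ → ℂ}
    (hf : MemLp f 2 (volume.restrict (Ioi (0 : ℝ)))) :
    Integrable (fun t => f t * (Ioc 0 L).indicator 1 t) (volume.restrict (Ioi (0 : ℝ))) := by
  have hfin : (volume.restrict (Ioi (0 : ℝ))) (Ioc 0 L) ≠ ⊤ :=
    ((Measure.restrict_apply_le _ _).trans_lt measure_Ioc_lt_top).ne
  exact hf.integrable_mul
    (memLp_indicator_const 2 measurableSet_Ioc (1 : ℂ) (Or.inr hfin))

/-- Conjugation in the first argument turns the frequency `-w` into `w`, so both factors of the rank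
one kernel carry the same frequency and multiply to a character of `t + s`. -/
theorem inner_truncatedCharLp_neg (L w : ℝ) (f : HalfLineL2) :
    inner ℂ (truncatedCharLp L (-w)) f = ∫ s in Ioi (0 : ℝ),
      f s * (Ioc 0 L).indicator 1 s * Complex.exp (((w * s : ℝ) : ℂ) * Complex.I) := by
  rw [L2.inner_def]
  refine integral_congr_ae ?_
  filter_upwards [coeFn_truncatedCharLp L (-w)] with s hs
  rw [hs, RCLike.inner_apply, truncatedChar_eq_mul]
  by_cases ht : s ∈ Ioc 0 L
  · simp [ht, ← Complex.exp_conj]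
  · simp [ht]

theorem inner_right_truncatedCharLp (L w : ℝ) (v : HalfLineL2) :
    inner ℂ v (truncatedCharLp L w) = ∫ t in Ioi (0 : ℝ),
      (starRingEnd ℂ (v t)) * (Ioc 0 L).indicator 1 t *
        Complex.exp (((w * t : ℝ) : ℂ) * Complex.I) := by
  rw [L2.inner_def]
  refine integral_congr_ae ?_
  filter_upwards [coeFn_truncatedCharLp L w] with s hs
  rw [hs, RCLike.inner_apply, truncatedChar_eq_mul]
  ring

/-- The integral Hankel operator of a kernel with an absolutely convergent Fourier
representation that vanishes on `(L, ∞)` is an integral of rank one operators. -/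
theorem isIntegralHankel_integral_rankOne {L : ℝ} (hL : 0 ≤ L) (w : ℝ) {g b : ℝ → ℂ}
    (hg : Integrable g) (hbc : Continuous b)
    (hb : ∀ x, b x = ∫ ξ, g ξ * Complex.exp (((w * ξ * x : ℝ) : ℂ) * Complex.I))
    (hb0 : ∀ x, L < x → b x = 0) :
    IsIntegralHankel b (∫ ξ, g ξ • InnerProductSpace.rankOne ℂ
      (truncatedCharLp L (w * ξ)) (truncatedCharLp L (-(w * ξ)))) := by
  intro f
  set A : HalfLineL2 →L[ℂ] HalfLineL2 := ∫ ξ, g ξ • InnerProductSpace.rankOne ℂ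
      (truncatedCharLp L (w * ξ)) (truncatedCharLp L (-(w * ξ))) with hA
  have hint := integrable_rankOne_truncatedChar hL w hg
  set F : ℝ → ℂ := fun ξ => inner ℂ (truncatedCharLp L (-(w * ξ))) f with hF
  have hFc : Continuous F := by
    have h2 : Continuous fun ξ => truncatedCharLp L (-(w * ξ)) :=
      (continuous_truncatedCharLp hL).comp (by fun_prop)
    exact h2.inner continuous_const
  have hgF : Integrable fun ξ => g ξ * F ξ := by
    refine hg.mul_bdd (c := √L * ‖f‖) hFc.aestronglyMeasurable (Eventually.of_forall fun ξ => ?_)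
    refine (norm_inner_le_norm _ _).trans (mul_le_mul_of_nonneg_right ?_ (norm_nonneg _))
    exact Real.le_sqrt_of_sq_le (norm_truncatedCharLp_sq_le hL _)
  -- `G` is the pointwise candidate for `A f`. As `A` is a Bochner integral of operators, the two
  -- are identified by pairing with arbitrary `v` and using Fubini's theorem.
  set G : ℝ → ℂ := fun t => (Ioc 0 L).indicator 1 t *
    ∫ ξ, g ξ * F ξ * Complex.exp (((w * ξ * t : ℝ) : ℂ) * Complex.I) with hG
  have hGmeas : Continuous fun t : ℝ =>
      ∫ ξ, g ξ * F ξ * Complex.exp (((w * ξ * t : ℝ) : ℂ) * Complex.I) := by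
    refine continuous_of_dominated (bound := fun ξ => ‖g ξ * F ξ‖) (fun t => ?_) (fun t => ?_)
      hgF.norm ?_
    · exact hgF.aestronglyMeasurable.mul (Continuous.aestronglyMeasurable (by fun_prop))
    · refine Eventually.of_forall fun ξ => ?_
      rw [norm_mul, Complex.norm_exp_ofReal_mul_I, mul_one]
    · exact Eventually.of_forall fun ξ => by fun_prop
  have hfin : (volume.restrict (Ioi (0 : ℝ))) (Ioc 0 L) ≠ ⊤ :=
    ((Measure.restrict_apply_le _ _).trans_lt measure_Ioc_lt_top).ne
  have hGmem : MemLp G 2 (volume.restrict (Ioi (0 : ℝ))) := by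
    refine (memLp_indicator_const 2 measurableSet_Ioc (∫ ξ, ‖g ξ * F ξ‖) (Or.inr hfin)).of_le
      ?_ (Eventually.of_forall fun t => ?_)
    · exact ((measurable_one.indicator measurableSet_Ioc).aestronglyMeasurable).mul
        hGmeas.aestronglyMeasurable
    · by_cases ht : t ∈ Ioc 0 L
      · simp only [hG, ht, indicator_of_mem, Pi.one_apply, one_mul]
        refine (norm_integral_le_integral_norm _).trans ?_
        simp only [norm_mul (_ * _), Complex.norm_exp_ofReal_mul_I, mul_one]
        exact le_abs_self _
      · simp [hG, ht]
  have hAG : A f = hGmem.toLp := by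
    refine ext_inner_left ℂ fun v => ?_
    have h1 : inner ℂ v (A f) = ∫ ξ, g ξ * F ξ * inner ℂ v (truncatedCharLp L (w * ξ)) := by
      have h := ContinuousLinearMap.integral_comp_comm
        ((innerSL ℂ v) ∘L (ContinuousLinearMap.apply ℂ HalfLineL2 f)) hint
      rw [← hA] at h
      simp only [ContinuousLinearMap.comp_apply, ContinuousLinearMap.apply_apply,
        innerSL_apply_apply] at h
      rw [← h]
      refine integral_congr_ae (Eventually.of_forall fun ξ => ?_)
      simp only [smul_apply, inner_smul_right,
        InnerProductSpace.inner_right_rankOne_apply, hF]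
      ring
    have h2 : inner ℂ v hGmem.toLp = ∫ t in Ioi (0 : ℝ),
        (starRingEnd ℂ (v t)) * (Ioc 0 L).indicator 1 t *
          ∫ ξ, g ξ * F ξ * Complex.exp (((w * ξ * t : ℝ) : ℂ) * Complex.I) := by
      rw [L2.inner_def]
      refine integral_congr_ae ?_
      filter_upwards [hGmem.coeFn_toLp] with t ht
      rw [ht, RCLike.inner_apply, hG]
      ring
    rw [h1, h2]
    simp_rw [inner_right_truncatedCharLp]
    exact (integral_mul_integral_char_comm w
      (integrable_mul_indicator L (Lp.memLp v).star) hgF).symm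
  have hbound : ∀ x, ‖b x‖ ≤ ∫ ξ, ‖g ξ‖ := fun x => by
    rw [hb]
    refine (norm_integral_le_integral_norm _).trans ?_
    simp only [norm_mul (g _), Complex.norm_exp_ofReal_mul_I, mul_one]
    exact le_rfl
  have hfL := integrable_mul_indicator L (Lp.memLp f)
  -- If `s > L`, then `t + s > L` and the kernel vanishes, so the cutoff costs nothing. It makes
  -- `f`, which is only in `L²`, integrable.
  have hcut : ∀ t s : ℝ, 0 < t → 0 < s →
      b (t + s) * f s = f s * (Ioc 0 L).indicator 1 s * b (t + s) := fun t s ht hs => by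
    by_cases hsL : s ∈ Ioc 0 L
    · simp [hsL, mul_comm]
    · have : L < s := by
        by_contra h
        exact hsL ⟨hs, not_lt.1 h⟩
      simp [hb0 (t + s) (by linarith)]
  rw [hAG]
  filter_upwards [hGmem.coeFn_toLp, ae_restrict_mem measurableSet_Ioi] with t htG ht
  have ht : 0 < t := ht
  constructor
  · have h : IntegrableOn (fun s => f s * (Ioc 0 L).indicator 1 s * b (t + s)) (Ioi 0) :=
      hfL.mul_bdd (c := ∫ ξ, ‖g ξ‖) (Continuous.aestronglyMeasurable (by fun_prop))
        (Eventually.of_forall fun s => hbound _)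
    exact h.congr_fun (fun s hs => (hcut t s ht hs).symm) measurableSet_Ioi
  · rw [htG, setIntegral_congr_fun measurableSet_Ioi fun s hs => hcut t s ht hs]
    by_cases htL : t ∈ Ioc 0 L
    · have hgt : Integrable fun ξ => g ξ * Complex.exp (((w * ξ * t : ℝ) : ℂ) * Complex.I) :=
        hg.mul_bdd (c := 1) (Continuous.aestronglyMeasurable (by fun_prop))
          (Eventually.of_forall fun ξ => (Complex.norm_exp_ofReal_mul_I _).le)
      have h3 := integral_mul_integral_char_comm w hfL hgt
      have h4 : ∀ s : ℝ, b (t + s) =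
          ∫ ξ, g ξ * Complex.exp (((w * ξ * t : ℝ) : ℂ) * Complex.I) *
            Complex.exp (((w * ξ * s : ℝ) : ℂ) * Complex.I) := fun s => by
        rw [hb]
        refine integral_congr_ae (Eventually.of_forall fun ξ => ?_)
        simp only [mul_assoc (g ξ), ← Complex.exp_add]
        push_cast
        ring_nf
      simp only [h4, h3, hG, htL, indicator_of_mem, Pi.one_apply, one_mul]
      refine integral_congr_ae (Eventually.of_forall fun ξ => ?_)
      simp only [hF, inner_truncatedCharLp_neg]
      ring
    · have hLt : L < t := by
        by_contra h
        exact htL ⟨ht, not_lt.1 h⟩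
      rw [setIntegral_congr_fun (g := fun _ => 0) measurableSet_Ioi fun s hs => by
        have hs : 0 < s := hs
        simp [hb0 (t + s) (by linarith)]]
      simp [hG, htL]

/-! ### Schur's test and the resulting Schatten bound. -/

theorem lintegral_enorm_sq_eq_one {u : HalfLineL2} (hu : ‖u‖ = 1) :
    ∫⁻ t in Ioi (0 : ℝ), ‖u t‖ₑ ^ 2 = 1 := by
  have h1 := eLpNorm_nnreal_pow_eq_lintegral (f := u) (p := 2)
    (μ := volume.restrict (Ioi (0 : ℝ))) two_ne_zero
  have h2 : eLpNorm u 2 (volume.restrict (Ioi (0 : ℝ))) = 1 := by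
    rw [← Lp.enorm_def, ← ofReal_norm, hu, ENNReal.ofReal_one]
  have h3 : eLpNorm u ((2 : NNReal) : ℝ≥0∞) (volume.restrict (Ioi (0 : ℝ))) = 1 := by
    simpa using h2
  rw [h3] at h1
  simpa using h1.symm

theorem two_mul_enorm_mul_le (x y : ℂ) : 2 * (‖x‖ₑ * ‖y‖ₑ) ≤ ‖x‖ₑ ^ 2 + ‖y‖ₑ ^ 2 := by
  simp only [enorm_eq_nnnorm]
  have := two_mul_le_add_sq ‖x‖₊ ‖y‖₊
  rw [mul_assoc] at this
  exact_mod_cast this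

/-- Schur's test: the norm of an integral Hankel operator is at most the `L¹` norm of its
kernel function. -/
theorem IsIntegralHankel.norm_inner_le {b : ℝ → ℂ} {A : HalfLineL2 →L[ℂ] HalfLineL2} {β : ℝ}
    (hA : IsIntegralHankel b A) (hb : Measurable b) (hβ0 : 0 ≤ β)
    (hβ : ∫⁻ x, ‖b x‖ₑ ≤ ENNReal.ofReal β) {u e : HalfLineL2} (hu : ‖u‖ = 1) (he : ‖e‖ = 1) :
    ‖inner ℂ u (A e)‖ ≤ β := by
  have hem : AEMeasurable (fun s => ‖e s‖ₑ) (volume.restrict (Ioi (0 : ℝ))) :=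
    (Lp.aestronglyMeasurable e).enorm
  have hum : AEMeasurable (fun s => ‖u s‖ₑ) (volume.restrict (Ioi (0 : ℝ))) :=
    (Lp.aestronglyMeasurable u).enorm
  have hbβ : ∀ t : ℝ, ∫⁻ s in Ioi (0 : ℝ), ‖b (t + s)‖ₑ ≤ ENNReal.ofReal β := fun t =>
    (setLIntegral_le_lintegral _ _).trans
      ((lintegral_add_left_eq_self (fun x => ‖b x‖ₑ) t).le.trans hβ)
  have hbm : Measurable fun z : ℝ × ℝ => ‖b (z.1 + z.2)‖ₑ := by fun_prop
  have h1 : ‖inner ℂ u (A e)‖ₑ ≤ ∫⁻ t in Ioi (0 : ℝ), ∫⁻ s in Ioi (0 : ℝ),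
      ‖b (t + s)‖ₑ * (‖u t‖ₑ * ‖e s‖ₑ) := by
    rw [L2.inner_def]
    refine (enorm_integral_le_lintegral_enorm _).trans (lintegral_mono_ae ?_)
    filter_upwards [hA e] with t ht
    rw [RCLike.inner_apply, ht.2, enorm_mul, mul_comm]
    calc ‖(starRingEnd ℂ) (u t)‖ₑ * ‖∫ s in Ioi (0 : ℝ), b (t + s) * e s‖ₑ
        ≤ ‖u t‖ₑ * ∫⁻ s in Ioi (0 : ℝ), ‖b (t + s) * e s‖ₑ := by
          rw [RCLike.enorm_conj]
          exact mul_le_mul_right (enorm_integral_le_lintegral_enorm _) _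
      _ = _ := by
          rw [← lintegral_const_mul'' _ (by
            simp only [enorm_mul]
            exact (Measurable.aemeasurable (by fun_prop)).mul hem)]
          simp only [enorm_mul]
          congr! 2
          ring
  have h2 : ∫⁻ t in Ioi (0 : ℝ), ∫⁻ s in Ioi (0 : ℝ), ‖b (t + s)‖ₑ * ‖u t‖ₑ ^ 2 ≤
      ENNReal.ofReal β := by
    calc _ ≤ ∫⁻ t in Ioi (0 : ℝ), ENNReal.ofReal β * ‖u t‖ₑ ^ 2 := by
          refine lintegral_mono fun t => ?_
          rw [lintegral_mul_const _ (by fun_prop)]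
          exact mul_le_mul_left (hbβ t) _
      _ = _ := by
          rw [lintegral_const_mul'' _ (hum.pow_const 2), lintegral_enorm_sq_eq_one hu, mul_one]
  have h3 : ∫⁻ t in Ioi (0 : ℝ), ∫⁻ s in Ioi (0 : ℝ), ‖b (t + s)‖ₑ * ‖e s‖ₑ ^ 2 ≤
      ENNReal.ofReal β := by
    rw [lintegral_lintegral_swap (hbm.aemeasurable.mul (hem.pow_const 2).comp_snd)]
    calc _ ≤ ∫⁻ s in Ioi (0 : ℝ), ENNReal.ofReal β * ‖e s‖ₑ ^ 2 := by
          refine lintegral_mono fun s => ?_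
          rw [lintegral_mul_const _ (by fun_prop)]
          refine mul_le_mul_left (le_of_eq_of_le ?_ (hbβ s)) _
          simp only [add_comm]
      _ = _ := by
          rw [lintegral_const_mul'' _ (hem.pow_const 2), lintegral_enorm_sq_eq_one he, mul_one]
  -- The bound `2|u||e| ≤ |u|² + |e|²` splits the double integral into `h2` and `h3`, where the
  -- kernel is integrated over one variable alone.
  have h4 : 2 * ‖inner ℂ u (A e)‖ₑ ≤ ENNReal.ofReal β + ENNReal.ofReal β := by
    calc 2 * ‖inner ℂ u (A e)‖ₑ
        ≤ 2 * ∫⁻ t in Ioi (0 : ℝ), ∫⁻ s in Ioi (0 : ℝ), ‖b (t + s)‖ₑ * (‖u t‖ₑ * ‖e s‖ₑ) :=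
          mul_le_mul_right h1 _
      _ = ∫⁻ t in Ioi (0 : ℝ), ∫⁻ s in Ioi (0 : ℝ),
            2 * (‖b (t + s)‖ₑ * (‖u t‖ₑ * ‖e s‖ₑ)) := by
          rw [← lintegral_const_mul' _ _ ENNReal.ofNat_ne_top]
          refine lintegral_congr fun t => ?_
          rw [← lintegral_const_mul' _ _ ENNReal.ofNat_ne_top]
      _ ≤ ∫⁻ t in Ioi (0 : ℝ), ∫⁻ s in Ioi (0 : ℝ),
            (‖b (t + s)‖ₑ * ‖u t‖ₑ ^ 2 + ‖b (t + s)‖ₑ * ‖e s‖ₑ ^ 2) := by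
          refine lintegral_mono fun t => lintegral_mono fun s => ?_
          rw [← mul_add, mul_left_comm]
          exact mul_le_mul_right (two_mul_enorm_mul_le _ _) _
      _ = (∫⁻ t in Ioi (0 : ℝ), ∫⁻ s in Ioi (0 : ℝ), ‖b (t + s)‖ₑ * ‖u t‖ₑ ^ 2) +
            ∫⁻ t in Ioi (0 : ℝ), ∫⁻ s in Ioi (0 : ℝ), ‖b (t + s)‖ₑ * ‖e s‖ₑ ^ 2 := by
          rw [← lintegral_add_left']
          · refine lintegral_congr fun t => ?_
            rw [lintegral_add_left (by fun_prop)]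
          · have : ∀ t, ∫⁻ s in Ioi (0 : ℝ), ‖b (t + s)‖ₑ * ‖u t‖ₑ ^ 2 =
                (∫⁻ s in Ioi (0 : ℝ), ‖b (t + s)‖ₑ) * ‖u t‖ₑ ^ 2 := fun t =>
              lintegral_mul_const _ (by fun_prop)
            simp only [this]
            exact hbm.lintegral_prod_right'.aemeasurable.mul (hum.pow_const 2)
      _ ≤ _ := add_le_add h2 h3
  rw [← two_mul] at h4
  have h5 := (ENNReal.mul_le_mul_iff_right two_ne_zero ENNReal.ofNat_ne_top).1 h4
  rw [← ofReal_norm] at h5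
  exact (ENNReal.ofReal_le_ofReal_iff hβ0).1 h5

/-- Existence and Schatten bounds for integral Hankel operators whose kernel function has an
absolutely convergent Fourier representation and vanishes on `(L, ∞)`. -/
theorem exists_isIntegralHankel_schattenSum_le {L β : ℝ} (hL : 0 ≤ L) (hβ0 : 0 ≤ β) (w : ℝ)
    {g b : ℝ → ℂ} (hg : Integrable g) (hbc : Continuous b)
    (hb : ∀ x, b x = ∫ ξ, g ξ * Complex.exp (((w * ξ * x : ℝ) : ℂ) * Complex.I))
    (hb0 : ∀ x, L < x → b x = 0) (hβ : ∫⁻ x, ‖b x‖ₑ ≤ ENNReal.ofReal β) :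
    ∃ A : HalfLineL2 →L[ℂ] HalfLineL2, IsIntegralHankel b A ∧ IsCompactOperator A ∧
      ∀ p : ℝ, 1 ≤ p →
        schattenSum p A ≤ ENNReal.ofReal (β ^ (p - 1) * (L * ∫ ξ, ‖g ξ‖)) := by
  have hA := isIntegralHankel_integral_rankOne hL w hg hbc hb hb0
  have hint := integrable_rankOne_truncatedChar hL w hg
  refine ⟨_, hA, isCompactOperator_integral_rankOne hint, fun p hp => ?_⟩
  refine schattenSum_le hp hβ0 (fun ι _ e u he hu => ?_)
    (fun u e hu he => hA.norm_inner_le hbc.measurable hβ0 hβ hu he)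
  exact norm_sum_inner_integral_rankOne_le hg hint rfl
    (fun ξ => norm_truncatedCharLp_sq_le hL _) (fun ξ => norm_truncatedCharLp_sq_le hL _) he hu

/-! ### Bumps, their rescalings and their Fourier representation. -/

theorem exists_isBump : ∃ a : ℝ → ℂ, IsBump a := by
  let f : ContDiffBump (1 : ℝ) := ⟨1 / 4, 1 / 2, by norm_num, by norm_num⟩
  refine ⟨fun x => ((f x : ℝ) : ℂ), Complex.ofRealCLM.contDiff.comp f.contDiff, ?_, ?_⟩
  · refine closure_minimal (fun x hx => ?_) isClosed_Icc
    have hx' : x ∈ Function.support f := fun h => hx (by simp [h])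
    rw [f.support_eq, Real.ball_eq_Ioo] at hx'
    have h1 : (1 : ℝ) - 1 / 2 < x := hx'.1
    have h2 : x < (1 : ℝ) + 1 / 2 := hx'.2
    constructor <;> linarith
  · have : f 1 = 1 := f.one_of_mem_closedBall (Metric.mem_closedBall_self (by norm_num))
    simp [this]

namespace IsBump

variable {a : ℝ → ℂ}

theorem hasCompactSupport (ha : IsBump a) : HasCompactSupport a :=
  isCompact_Icc.of_isClosed_subset (isClosed_tsupport a) ha.2.1

theorem mem_Icc (ha : IsBump a) {x : ℝ} (hx : a x ≠ 0) : x ∈ Icc (1 / 2 : ℝ) 2 :=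
  ha.2.1 (subset_tsupport a hx)

/-- The support condition allows the endpoint 2; continuity gives the zero there. The endpoint is
needed for `N = j = 1`, where the bump is evaluated at exactly `1 + N * j = 2`. -/
theorem apply_eq_zero (ha : IsBump a) {x : ℝ} (hx : 2 ≤ x) : a x = 0 := by
  have hclosed : IsClosed {x | a x = 0} := isClosed_eq ha.1.continuous continuous_const
  have h : Ioi (2 : ℝ) ⊆ {x | a x = 0} := fun y hy => by
    by_contra h
    exact absurd (ha.mem_Icc h).2 (not_le.2 hy)
  have h2 := hclosed.closure_subset_iff.2 h
  rw [closure_Ioi] at h2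
  exact h2 hx

/-- The rescaled bump at the point `lam` has its support close to `lam`. -/
theorem tsupport_rescale_subset (ha : IsBump a) (lam : ℝ) {N : ℕ} (hN : 1 ≤ N) :
    tsupport (fun t => a (1 + N * (t - lam))) ⊆
      Icc (lam - 1 / (2 * (N : ℝ))) (lam + 1 / (N : ℝ)) := by
  have hN0 : (0 : ℝ) < N := by exact_mod_cast hN
  refine closure_minimal (fun t ht => ?_) isClosed_Icc
  obtain ⟨h1, h2⟩ := ha.mem_Icc ht
  constructor
  · rw [sub_le_iff_le_add, ← sub_le_iff_le_add', le_div_iff₀ (by positivity)]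
    nlinarith
  · rw [← sub_le_iff_le_add', le_div_iff₀ hN0]
    nlinarith

theorem contDiff_rescale (ha : IsBump a) (lam : ℝ) (N : ℕ) :
    ContDiff ℝ ∞ fun t => a (1 + N * (t - lam)) :=
  ha.1.comp (by fun_prop)

theorem pointwiseRestriction_rescale_zero (ha : IsBump a) (lam : ℝ) (N : ℕ) :
    pointwiseRestriction lam (fun t => a (1 + N * (t - lam))) 0 = 1 := by
  simp [pointwiseRestriction, ha.2.2]

theorem pointwiseRestriction_rescale_of_one_le (ha : IsBump a) (lam : ℝ) {N j : ℕ}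
    (hN : 1 ≤ N) (hj : 1 ≤ j) :
    pointwiseRestriction lam (fun t => a (1 + N * (t - lam))) j = 0 := by
  refine ha.apply_eq_zero ?_
  have : (1 : ℝ) ≤ N * j := by exact_mod_cast Nat.mul_pos hN hj
  linarith [show (1 : ℝ) + N * (j + lam - lam) = 1 + N * j by ring]

/-- Fourier inversion. -/
theorem exists_fourier_representation (ha : IsBump a) :
    ∃ g : ℝ → ℂ, Integrable g ∧
      ∀ x, a x = ∫ ξ, g ξ * Complex.exp (((2 * Real.pi * ξ * x : ℝ) : ℂ) * Complex.I) := by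
  let S : SchwartzMap ℝ ℂ := ha.hasCompactSupport.toSchwartzMap ha.1
  have hS : (S : ℝ → ℂ) = a := rfl
  have hint : Integrable (FourierTransform.fourier a) := by
    rw [← hS, ← SchwartzMap.fourier_coe]
    exact SchwartzMap.integrable _
  refine ⟨FourierTransform.fourier a, hint, fun x => ?_⟩
  have h := ha.1.continuous.fourierInv_fourier_eq (by rw [← hS]; exact S.integrable) hint
  nth_rewrite 1 [← h]
  rw [Real.fourierInv_eq']
  refine integral_congr_ae (Eventually.of_forall fun ξ => ?_)
  simp only [smul_eq_mul, RCLike.inner_apply, conj_trivial]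
  rw [mul_comm]
  congr! 4
  ring

/-- The `L¹` norm of a rescaled bump is of order `1 / N`. -/
theorem exists_lintegral_rescale_le (ha : IsBump a) :
    ∃ M : ℝ, 0 ≤ M ∧ ∀ (lam : ℝ) (N : ℕ), 1 ≤ N →
      ∫⁻ t, ‖a (1 + N * (t - lam))‖ₑ ≤ ENNReal.ofReal (M / N) := by
  obtain ⟨M, hM⟩ := ha.1.continuous.bounded_above_of_compact_support ha.hasCompactSupport
  have hM0 : 0 ≤ M := (norm_nonneg _).trans (hM 0)
  -- The support has length at most `3 / (2 * N)`, rounded up to `2 / N`.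
  refine ⟨M * 2, by positivity, fun lam N hN => ?_⟩
  have hN0 : (0 : ℝ) < N := by exact_mod_cast hN
  set I := Icc (lam - 1 / (2 * (N : ℝ))) (lam + 1 / (N : ℝ)) with hI
  calc ∫⁻ t, ‖a (1 + N * (t - lam))‖ₑ ≤ ∫⁻ t, I.indicator (fun _ => ENNReal.ofReal M) t := by
        refine lintegral_mono fun t => ?_
        by_cases ht : t ∈ I
        · rw [indicator_of_mem ht, ← ofReal_norm]
          exact ENNReal.ofReal_le_ofReal (hM _)
        · have h := image_eq_zero_of_notMem_tsupport
            fun h => ht (ha.tsupport_rescale_subset lam hN h)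
          simp [h]
    _ = ENNReal.ofReal (M * (lam + 1 / (N : ℝ) - (lam - 1 / (2 * (N : ℝ))))) := by
        rw [lintegral_indicator_const measurableSet_Icc, Real.volume_Icc,
          ← ENNReal.ofReal_mul hM0]
    _ ≤ _ := by
        refine ENNReal.ofReal_le_ofReal ?_
        rw [mul_div_assoc]
        refine mul_le_mul_of_nonneg_left ?_ hM0
        have : (0 : ℝ) < 1 / N := by positivity
        have h2 : 1 / (2 * (N : ℝ)) = 1 / 2 * (1 / N) := by ring
        have h3 : (2 : ℝ) / N = 2 * (1 / N) := by ring
        rw [h2, h3]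
        linarith

/-- The integral Hankel operators of the rescaled bumps, with their Schatten bounds. -/
theorem exists_isIntegralHankel_rescale (ha : IsBump a) {lam : ℝ} (hlam : 0 < lam) :
    ∃ (A : ℕ → HalfLineL2 →L[ℂ] HalfLineL2) (C : ℝ → ℝ), (∀ p, 0 < C p) ∧ ∀ N : ℕ, 1 ≤ N →
      IsIntegralHankel (fun t => a (1 + N * (t - lam))) (A N) ∧
        ∀ p, 1 ≤ p → MemSchatten p (A N) ∧
          (schattenSum p (A N)).toReal ≤ C p * (N : ℝ) ^ (1 - p) := by
  obtain ⟨g, hg, hag⟩ := ha.exists_fourier_representation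
  obtain ⟨M, hM0, hM⟩ := ha.exists_lintegral_rescale_le
  -- The cutoff `L = lam + 1` serves all `N ≥ 1`, since the supports end by `lam + 1 / N`.
  have hL : 0 ≤ lam + 1 := by linarith
  have hmain : ∀ N : ℕ, 1 ≤ N → ∃ A : HalfLineL2 →L[ℂ] HalfLineL2,
      IsIntegralHankel (fun t => a (1 + N * (t - lam))) A ∧ IsCompactOperator A ∧
      ∀ p : ℝ, 1 ≤ p → schattenSum p A ≤
        ENNReal.ofReal ((M / N) ^ (p - 1) * ((lam + 1) * ∫ ξ, ‖g ξ‖)) := by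
    intro N hN
    have hN1 : (1 : ℝ) ≤ N := by exact_mod_cast hN
    -- Inserting `1 + N * (t - lam)` into the Fourier formula gives frequencies `2πNξ` in `t` and a
    -- phase independent of `t`. Absorbed into `g`, the phase preserves `‖g ξ‖`.
    set h : ℝ → ℂ := fun ξ => g ξ *
      Complex.exp (((2 * Real.pi * ξ * (1 - N * lam) : ℝ) : ℂ) * Complex.I) with hh
    have hnorm : ∀ ξ, ‖h ξ‖ = ‖g ξ‖ := fun ξ => by
      simp only [hh, norm_mul (g _), Complex.norm_exp_ofReal_mul_I, mul_one]
    have hint : Integrable h := hg.mul_bdd (c := 1)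
      (Continuous.aestronglyMeasurable (by fun_prop))
      (Eventually.of_forall fun ξ => (Complex.norm_exp_ofReal_mul_I _).le)
    simp_rw [← hnorm]
    refine exists_isIntegralHankel_schattenSum_le hL (by positivity) (2 * Real.pi * N) hint
      (ha.contDiff_rescale lam N).continuous (fun x => ?_) (fun x hx => ?_) (hM lam N hN)
    · rw [hag]
      refine integral_congr_ae (Eventually.of_forall fun ξ => ?_)
      simp only [hh, mul_assoc (g ξ), ← Complex.exp_add]
      push_cast
      ring_nf
    · exact ha.apply_eq_zero (by nlinarith)
  choose! A hA1 hA2 hA3 using hmain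
  set K : ℝ := (lam + 1) * ∫ ξ, ‖g ξ‖ with hK
  have hK0 : 0 ≤ K := mul_nonneg hL (integral_nonneg fun _ => norm_nonneg _)
  -- The summand 1 only makes the constant strictly positive.
  refine ⟨A, fun p => M ^ (p - 1) * K + 1, fun p => ?_, fun N hN => ⟨hA1 N hN, fun p hp =>
    ⟨⟨hA2 N hN, (hA3 N hN p hp).trans_lt ENNReal.ofReal_lt_top⟩, ?_⟩⟩⟩
  · have := Real.rpow_nonneg hM0 (p - 1)
    positivity
  · have hpow := Real.rpow_nonneg (Nat.cast_nonneg (α := ℝ) N) (1 - p)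
    refine (ENNReal.toReal_le_of_le_ofReal ?_ (hA3 N hN p hp)).trans ?_
    · exact mul_nonneg (Real.rpow_nonneg (by positivity) _) hK0
    · rw [Real.div_rpow hM0 (Nat.cast_nonneg N), div_eq_mul_inv, ← Real.rpow_neg
        (Nat.cast_nonneg N), neg_sub]
      nlinarith

end IsBump

/-! ### Passage to the limit and the main theorem. -/

theorem schattenNorm_rpow {E : Type*} [NormedAddCommGroup E] [InnerProductSpace ℂ E]
    [CompleteSpace E] {p : ℝ} (hp : p ≠ 0) (A : E →L[ℂ] E) :
    schattenNorm p A ^ p = (schattenSum p A).toReal := by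
  rw [schattenNorm, ← Real.rpow_mul ENNReal.toReal_nonneg, one_div_mul_cancel hp, Real.rpow_one]

theorem tendsto_zero_of_le_mul_rpow {f : ℕ → ℝ} {C p : ℝ} (hp : 1 < p) (h0 : ∀ N, 0 ≤ f N)
    (hf : ∀ N : ℕ, 1 ≤ N → f N ≤ C * (N : ℝ) ^ (1 - p)) : Tendsto f atTop (𝓝 0) := by
  have h : Tendsto (fun N : ℕ => C * (N : ℝ) ^ (1 - p)) atTop (𝓝 0) := by
    have h1 := (tendsto_rpow_neg_atTop (sub_pos.2 hp)).comp tendsto_natCast_atTop_atTop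
    simpa [neg_sub, Function.comp_def] using h1.const_mul C
  exact squeeze_zero' (Eventually.of_forall h0)
    ((eventually_ge_atTop 1).mono fun N hN => hf N hN) h

theorem mainTheorem2 :
    (∃ a : ℝ → ℂ, IsBump a) ∧
    (∀ a : ℝ → ℂ, IsBump a →
      (∀ N : ℕ, 1 ≤ N →
        tsupport (rescaledBump a N) ⊆ Icc (1 - 1 / (2 * (N : ℝ))) (1 + 1 / (N : ℝ)) ∧
        pointwiseRestriction 1 (rescaledBump a N) 0 = 1 ∧
        ∀ j : ℕ, 1 ≤ j → pointwiseRestriction 1 (rescaledBump a N) j = 0) ∧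
      ∃ (A : ℕ → HalfLineL2 →L[ℂ] HalfLineL2) (B : ℕ → SeqL2 →L[ℂ] SeqL2),
        (∀ N : ℕ, 1 ≤ N →
          IsIntegralHankel (rescaledBump a N) (A N) ∧
          IsHankelMatrix (pointwiseRestriction 1 (rescaledBump a N)) (B N)) ∧
        (∀ p : ℝ, 1 ≤ p → ∀ N : ℕ, 1 ≤ N →
          MemSchatten p (B N) ∧ schattenNorm p (B N) = 1) ∧
        (∀ p : ℝ, 1 ≤ p → ∃ C : ℝ, 0 < C ∧ ∀ N : ℕ, 1 ≤ N →
          MemSchatten p (A N) ∧ schattenNorm p (A N) ^ p ≤ C * (N : ℝ) ^ (1 - p)) ∧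
        (∀ p : ℝ, 1 < p → Tendsto (fun N : ℕ => schattenNorm p (A N) ^ p) atTop (𝓝 0))) ∧
    (∀ p : ℝ, 1 < p → ∀ lam : ℝ, 0 < lam → ∀ C : ℝ,
      ∃ (b : ℝ → ℂ) (A : HalfLineL2 →L[ℂ] HalfLineL2) (B : SeqL2 →L[ℂ] SeqL2),
        ContDiff ℝ ∞ b ∧ HasCompactSupport b ∧ tsupport b ⊆ Ioi 0 ∧
        IsIntegralHankel b A ∧ MemSchatten p A ∧
        IsHankelMatrix (pointwiseRestriction lam b) B ∧ MemSchatten p B ∧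
        C * schattenNorm p A < schattenNorm p B) := by
  refine ⟨exists_isBump, fun a ha => ⟨fun N hN => ⟨ha.tsupport_rescale_subset 1 hN,
    ha.pointwiseRestriction_rescale_zero 1 N,
    fun j hj => ha.pointwiseRestriction_rescale_of_one_le 1 hN hj⟩, ?_⟩, ?_⟩
  · obtain ⟨A, C, hC, hA⟩ := ha.exists_isIntegralHankel_rescale one_pos
    have hAp : ∀ p : ℝ, 1 ≤ p → ∀ N : ℕ, 1 ≤ N →
        MemSchatten p (A N) ∧ schattenNorm p (A N) ^ p ≤ C p * (N : ℝ) ^ (1 - p) :=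
      fun p hp N hN => ⟨((hA N hN).2 p hp).1, by
        rw [schattenNorm_rpow (by linarith)]
        exact ((hA N hN).2 p hp).2⟩
    refine ⟨A, fun _ => InnerProductSpace.rankOne ℂ (lp.single 2 0 (1 : ℂ) : SeqL2)
      (lp.single 2 0 (1 : ℂ)), fun N hN => ⟨(hA N hN).1, isHankelMatrix_rankOne
        (ha.pointwiseRestriction_rescale_zero 1 N)
        fun j hj => ha.pointwiseRestriction_rescale_of_one_le 1 hN hj⟩,
      fun p _ N _ => ⟨memSchatten_rankOne_self norm_single_zero_one p,
        schattenNorm_rankOne_self norm_single_zero_one p⟩,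
      fun p hp => ⟨C p, hC p, hAp p hp⟩, fun p hp => ?_⟩
    refine tendsto_zero_of_le_mul_rpow hp (fun N => ?_) fun N hN => (hAp p hp.le N hN).2
    rw [schattenNorm_rpow (by linarith)]
    exact ENNReal.toReal_nonneg
  · intro p hp lam hlam C
    obtain ⟨a, ha⟩ := exists_isBump
    obtain ⟨A, C', -, hA⟩ := ha.exists_isIntegralHankel_rescale hlam
    have hlim : Tendsto (fun N : ℕ => C * schattenNorm p (A N)) atTop (𝓝 0) := by
      have h1 : Tendsto (fun N : ℕ => (schattenSum p (A N)).toReal) atTop (𝓝 0) :=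
        tendsto_zero_of_le_mul_rpow hp (fun N => ENNReal.toReal_nonneg)
          fun N hN => ((hA N hN).2 p hp.le).2
      have hp' : 0 < 1 / p := by positivity
      have h2 := (h1.rpow_const (p := 1 / p) (Or.inr hp'.le)).const_mul C
      rwa [Real.zero_rpow hp'.ne', mul_zero] at h2
    -- The condition `N > 1 / lam` keeps the left end `lam - 1 / (2 * N)` of the support positive;
    -- `hNC` puts `C` times the norm of the integral operator below 1, the norm of the Hankel
    -- matrix.
    obtain ⟨N, hNC, hN, hNlam⟩ := ((hlim.eventually_lt_const one_pos).and
      ((eventually_ge_atTop 1).and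
        (tendsto_natCast_atTop_atTop.eventually_gt_atTop (1 / lam)))).exists
    have hsupp := ha.tsupport_rescale_subset lam hN
    refine ⟨fun t => a (1 + N * (t - lam)), A N, InnerProductSpace.rankOne ℂ
      (lp.single 2 0 (1 : ℂ) : SeqL2) (lp.single 2 0 (1 : ℂ)), ha.contDiff_rescale lam N,
      isCompact_Icc.of_isClosed_subset (isClosed_tsupport _) hsupp, fun t ht => ?_,
      (hA N hN).1, ((hA N hN).2 p hp.le).1, isHankelMatrix_rankOne
        (ha.pointwiseRestriction_rescale_zero lam N)
        fun j hj => ha.pointwiseRestriction_rescale_of_one_le lam hN hj,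
      memSchatten_rankOne_self norm_single_zero_one p, ?_⟩
    · have hN0 : (0 : ℝ) < N := by exact_mod_cast hN
      have h1 := (hsupp ht).1
      have h2 : 1 / (2 * (N : ℝ)) < lam := by
        rw [div_lt_iff₀ hlam] at hNlam
        rw [div_lt_iff₀ (by positivity)]
        nlinarith
      exact lt_of_lt_of_le (sub_pos.2 h2) h1
    · rw [schattenNorm_rankOne_self norm_single_zero_one]
      exact hNC
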